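/- Let $n\in\mathbb{N}$ ($n\ge 0$), let $X_0,\dots,X_n$ be Abelian Polish groups, and for each $k\le n$ let $\mathcal{I}_k\in\{\mathcal{M}(X_k),\mathcal{N}(X_k)\}$, where $\mathcal{M}(X_k)$ is the family of meager subsets of $X_k$, and $\mathcal{N}(X_k)$ is the family of subsets of $X_k$ of Haar measure zero; the choice $\mathcal{I}_k=\mathcal{N}(X_k)$ is allowed when $X_k$ is locally compact (for instance $\mathbb{R}$ with Lebesgue measure or $2^\omega$ with the product measure). For families $\mathcal{I}\subseteq P(X)$ and $\mathcal{J}\subseteq P(Y)$ on Polish spaces $X$ and $Y$, the Fubini product $\mathcal{I}\otimes\mathcal{J}\subseteq P(X\times Y)$ consists of all $K\subseteq X\times Y$ for which there is a set $C\supseteq K$ in the $\sigma$-algebra $\mathrm{Bor}(X)\otimes\mathrm{Bor}(Y)$ generated by the rectangles $A\times B$ with $A\in\mathrm{Bor}(X)$, $B\in\mathrm{Bor}(Y)$ such that $\{x\in X: C_x\notin\mathcal{J}\}\in\mathcal{I}$, where $C_x=\{y\in Y:(x,y)\in C\}$. Then the iterated Fubini product $\mathcal{I}_0\otimes\mathcal{I}_1\otimes\dots\otimes\mathcal{I}_n$,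 with brackets placed in any way, has the Weaker Smital Property on the group $X_0\times X_1\times\dots\times X_n$ (bracketed in the same way): there is a countable dense set $D\subseteq X_0\times\dots\times X_n$ such that for every Borel set $A\subseteq X_0\times\dots\times X_n$ with $A\notin\mathcal{I}_0\otimes\dots\otimes\mathcal{I}_n$, the complement of $A+D=\{a+d:a\in A,\ d\in D\}$ belongs to $\mathcal{I}_0\otimes\dots\otimes\mathcal{I}_n$. -/

import Mathlib

open scoped Pointwise MeasureTheory

universe u

namespace Smital

/-- The family of meager subsets of `X`. -/
def meagerIdeal (X : Type u) [TopologicalSpace X] : Set (Set X) :=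
  {A | IsMeagre A}

/-- The family of null subsets of a locally compact group `X`, i.e. the sets of (outer) Haar
measure zero. Haar measures of a second countable locally compact group are all proportional, so
the choice of the Haar measure is irrelevant. -/
def nullIdeal (X : Type u) [AddCommGroup X] [TopologicalSpace X] : Set (Set X) :=
  letI : MeasurableSpace X := borel X
  {A | ∃ μ : MeasureTheory.Measure X, μ.IsAddHaarMeasure ∧ μ A = 0}

/-- The Fubini product of `(𝒜, I)` and `(ℬ, J)`. Here `𝒜.prod ℬ` is the σ-algebra generated by
the rectangles `A × B` with `A ∈ 𝒜`, `B ∈ ℬ`. -/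
def fubiniProduct {X Y : Type u} (𝒜 : MeasurableSpace X) (ℬ : MeasurableSpace Y)
    (I : Set (Set X)) (J : Set (Set Y)) : Set (Set (X × Y)) :=
  {K | ∃ C : Set (X × Y), MeasurableSet[𝒜.prod ℬ] C ∧ K ⊆ C ∧
    {x : X | {y : Y | (x, y) ∈ C} ∉ J} ∈ I}

/-- The Weaker Smital Property of the pair `(𝒜, I)`: there is a countable dense set `D` such that
`A + D` has complement in `I` for every `A ∈ 𝒜 \ I`. -/
def HasWSP {X : Type u} [AddCommGroup X] [TopologicalSpace X]
    (𝒜 : MeasurableSpace X) (I : Set (Set X)) : Prop :=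
  ∃ D : Set X, D.Countable ∧ Dense D ∧
    ∀ A : Set X, MeasurableSet[𝒜] A → A ∉ I → (A + D)ᶜ ∈ I

/-- `Bracketing m a b` is the type of all ways of putting brackets in a product of the
consecutive factors with indices `a, a + 1, …, b - 1` (a nonempty range below `m`). -/
inductive Bracketing (m : ℕ) : ℕ → ℕ → Type
  | factor (k : Fin m) : Bracketing m (k : ℕ) ((k : ℕ) + 1)
  | prod {a b c : ℕ} (s : Bracketing m a b) (t : Bracketing m b c) : Bracketing m a c

namespace Bracketing

/-- The product of the spaces `X k`, bracketed in the given way. -/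
def Space {m : ℕ} (X : Fin m → Type u) : {a b : ℕ} → Bracketing m a b → Type u
  | _, _, factor k => X k
  | _, _, prod s t => s.Space X × t.Space X

/-- The coordinatewise group structure. -/
instance instAddCommGroupSpace {m : ℕ} (X : Fin m → Type u) [∀ k, AddCommGroup (X k)] :
    {a b : ℕ} → (s : Bracketing m a b) → AddCommGroup (s.Space X)
  | _, _, factor k => inferInstanceAs (AddCommGroup (X k))
  | _, _, prod s t =>
    letI := instAddCommGroupSpace X s
    letI := instAddCommGroupSpace X t
    inferInstanceAs (AddCommGroup (s.Space X × t.Space X))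

/-- The product topology. -/
instance instTopologicalSpaceSpace {m : ℕ} (X : Fin m → Type u) [∀ k, TopologicalSpace (X k)] :
    {a b : ℕ} → (s : Bracketing m a b) → TopologicalSpace (s.Space X)
  | _, _, factor k => inferInstanceAs (TopologicalSpace (X k))
  | _, _, prod s t =>
    letI := instTopologicalSpaceSpace X s
    letI := instTopologicalSpaceSpace X t
    inferInstanceAs (TopologicalSpace (s.Space X × t.Space X))

/-- The iterated Fubini product of the families `I k`, each considered with the Borel σ-algebra,
bracketed in the given way. -/
def fubini {m : ℕ} (X : Fin m → Type u) [∀ k, TopologicalSpace (X k)]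
    (I : ∀ k, Set (Set (X k))) : {a b : ℕ} → (s : Bracketing m a b) → Set (Set (s.Space X))
  | _, _, factor k => I k
  | _, _, prod s t =>
    fubiniProduct (borel (s.Space X)) (borel (t.Space X)) (s.fubini X I) (t.fubini X I)

end Bracketing

end Smital

namespace Smital

open MeasureTheory Set Filter TopologicalSpace Topology

/-! ### Meager sets -/

/-! The Weaker Smital Property passes to Fubini products once two conditions join it: heredity, and
measurability of the set of parameters with small section. Let `D₁`, `D₂` witness the property for
`I`, `J`. If a Borel `A` is not in the product, the `a` with `A_a ∉ J` form a measurable set outside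
`I`, so its translates by `D₁` cover all but an `I`-small set. Over `a + d` the section of `A + D₁
×ˢ D₂` contains `A_a + D₂`, whose complement is in `J`. Induction on the bracketing leaves single
factors: the Baire property settles meager sets, Fubini and Steinhaus settle null sets. -/

theorem isMeagre_iff_residualEq_empty {X : Type*} [TopologicalSpace X] {s : Set X} :
    IsMeagre s ↔ s =ᶠ[residual X] (∅ : Set X) :=
  eventuallyEq_empty.symm

/-- A Borel set is comeager in an open set `U` iff it is non-meager in every basic open subset
of `U`. -/
theorem isMeagre_compl_inter_iff {X : Type*} [TopologicalSpace X] [BaireSpace X]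
    [SecondCountableTopology X] [MeasurableSpace X] [BorelSpace X] {s U : Set X}
    (hs : MeasurableSet s) (hU : IsOpen U) :
    IsMeagre (sᶜ ∩ U) ↔ ∀ V ∈ countableBasis X, V ⊆ U → ¬ IsMeagre (s ∩ V) := by
  constructor
  · intro h V hV hVU hm
    refine not_isMeagre_of_isOpen (isOpen_of_mem_countableBasis hV)
      (nonempty_of_mem_countableBasis hV) ((hm.union h).mono fun x hx => ?_)
    by_cases hxs : x ∈ s
    · exact Or.inl ⟨hxs, hx⟩
    · exact Or.inr ⟨hxs, hVU hx⟩
  · intro h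
    by_contra hm
    -- Modulo meager sets `sᶜ` is the open set `W`, so `s` is meager in any basic open subset of `W
    -- ∩ U`.
    obtain ⟨W, hW, hsW⟩ := hs.compl.residualEq_isOpen
    have hne : (W ∩ U).Nonempty := by
      rw [nonempty_iff_ne_empty]
      intro he
      apply hm
      rw [isMeagre_iff_residualEq_empty, ← he]
      exact hsW.inter .rfl
    obtain ⟨x, hx⟩ := hne
    obtain ⟨V, hV, -, hVW⟩ :=
      (isBasis_countableBasis X).exists_subset_of_mem_open hx (hW.inter hU)
    refine h V hV (hVW.trans inter_subset_right) (IsMeagre.mono (s := s ∩ W)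
      (inter_subset_inter_right _ (hVW.trans inter_subset_left)) ?_)
    rw [isMeagre_iff_residualEq_empty, ← inter_compl_self s]
    exact EventuallyEq.rfl.inter hsW.symm

/-- **Novikov's theorem**: the points whose section is meager in a given open set form a measurable
set. -/
theorem measurableSet_setOf_isMeagre_inter {Z X : Type*} [MeasurableSpace Z] [TopologicalSpace X]
    [BaireSpace X] [SecondCountableTopology X] [MeasurableSpace X] [BorelSpace X]
    {E : Set (Z × X)} (hE : MeasurableSet E) :
    ∀ U : Set X, IsOpen U → MeasurableSet {z | IsMeagre (Prod.mk z ⁻¹' E ∩ U)} := by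
  -- `U` stays quantified: the complement case needs the hypothesis for all basic open sets.
  induction E, hE using MeasurableSpace.induction_on_inter generateFrom_prod.symm
    isPiSystem_prod with
  | empty => intro U _; simp [IsMeagre.empty]
  | basic E hE =>
    obtain ⟨A, hA, B, -, rfl⟩ := hE
    intro U _
    have : {z | IsMeagre (Prod.mk z ⁻¹' A ×ˢ B ∩ U)} = Aᶜ ∪ {_z | IsMeagre (B ∩ U)} := by
      ext z
      by_cases hz : z ∈ A <;> simp [hz, IsMeagre.empty]
    rw [this]
    exact (MeasurableSet.compl hA).union (.const _)
  | compl E hE ih =>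
    intro U hU
    have : {z | IsMeagre (Prod.mk z ⁻¹' Eᶜ ∩ U)} =
        ⋂ V ∈ countableBasis X, {z | V ⊆ U → ¬ IsMeagre (Prod.mk z ⁻¹' E ∩ V)} := by
      ext z
      simpa using isMeagre_compl_inter_iff (measurable_prodMk_left hE) hU
    rw [this]
    refine MeasurableSet.biInter (countable_countableBasis X) fun V hV => ?_
    by_cases hVU : V ⊆ U
    · simpa only [hVU, true_imp_iff] using! (ih V (isOpen_of_mem_countableBasis hV)).compl
    · simp [hVU]
  | iUnion f _ _ ih =>
    intro U hU
    have : {z | IsMeagre (Prod.mk z ⁻¹' (⋃ i, f i) ∩ U)} =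
        ⋂ i, {z | IsMeagre (Prod.mk z ⁻¹' f i ∩ U)} := by
      ext z
      simp only [preimage_iUnion, iUnion_inter, mem_ofPred_eq, mem_iInter]
      exact ⟨fun h i => h.mono (subset_iUnion (fun i => Prod.mk z ⁻¹' f i ∩ U) i),
        isMeagre_iUnion⟩
    rw [this]
    exact MeasurableSet.iInter fun i => ih i U hU

/-- The sum of a non-meager Borel set and a dense set is comeager. -/
theorem isMeagre_compl_add_dense {X : Type*} [AddCommGroup X] [TopologicalSpace X]
    [IsTopologicalAddGroup X] [MeasurableSpace X] [BorelSpace X] {A D : Set X}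
    (hA : MeasurableSet A) (hm : ¬ IsMeagre A) (hDc : D.Countable) (hD : Dense D) :
    IsMeagre (A + D)ᶜ := by
  obtain ⟨U, hU, hAU⟩ := hA.residualEq_isOpen
  have hne : U.Nonempty := by
    rw [nonempty_iff_ne_empty]
    rintro rfl
    exact hm (isMeagre_iff_residualEq_empty.2 hAU)
  obtain ⟨u, hu⟩ := hne
  have hUD : (⋃ d ∈ D, (fun x => x - d) ⁻¹' U) = univ := by
    refine eq_univ_of_forall fun x => ?_
    obtain ⟨d, hdU, hd⟩ := hD.inter_open_nonempty ((fun d => x - d) ⁻¹' U)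
      (hU.preimage (by fun_prop)) ⟨x - u, by simpa⟩
    exact mem_biUnion hd hdU
  have hAD : A + D = ⋃ d ∈ D, (fun x => x - d) ⁻¹' A := by
    ext x
    simp only [Set.mem_add, mem_iUnion, mem_preimage, exists_prop]
    constructor
    · rintro ⟨a, ha, d, hd, rfl⟩
      exact ⟨d, hd, by simpa⟩
    · rintro ⟨d, hd, h⟩
      exact ⟨_, h, d, hd, by simp⟩
  -- Translation preserves equality modulo meager sets, and the union is countable, so `A` may
  -- replace `U` in the cover.
  have key : (A + D : Set X) =ᶠ[residual X] (univ : Set X) := by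
    rw [hAD, ← hUD]
    refine Filter.EventuallyEq.countable_bUnion hDc fun d _ => ?_
    exact (tendsto_residual_of_isOpenMap (Homeomorph.subRight d).continuous
      (Homeomorph.subRight d).isOpenMap).eventually hAU
  rw [isMeagre_iff_residualEq_empty, ← compl_univ]
  exact key.compl

/-! ### Haar null sets -/

theorem mem_nullIdeal_iff {X : Type u} [AddCommGroup X] [TopologicalSpace X]
    [IsTopologicalAddGroup X] [LocallyCompactSpace X] [SecondCountableTopology X]
    [MeasurableSpace X] [BorelSpace X] (μ : Measure X) [μ.IsAddHaarMeasure] {A : Set X} :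
    A ∈ nullIdeal X ↔ μ A = 0 := by
  borelize X
  constructor
  · rintro ⟨ν, hν, h⟩
    rw [Measure.isAddLeftInvariant_eq_smul μ ν]
    simp [h]
  · intro h
    exact ⟨μ, inferInstance, h⟩

/-- The sum of a measurable set of positive Haar measure and a dense set meets every measurable set
of positive measure. -/
theorem inter_add_dense_nonempty {X : Type*} [AddCommGroup X] [TopologicalSpace X]
    [IsTopologicalAddGroup X] [LocallyCompactSpace X] [SecondCountableTopology X]
    [MeasurableSpace X] [BorelSpace X] (μ : Measure X) [μ.IsAddHaarMeasure] {A B D : Set X}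
    (hA : MeasurableSet A) (hμA : μ A ≠ 0) (hB : MeasurableSet B) (hμB : μ B ≠ 0)
    (hD : Dense D) : (B ∩ (A + D)).Nonempty := by
  -- Fubini: if every `B ∩ (A + x)` were null, then `y - A` would be null for almost every `y ∈ B`,
  -- forcing `μ A = 0`.
  obtain ⟨x, hx⟩ : ∃ x, μ (B ∩ (fun y => y - x) ⁻¹' A) ≠ 0 := by
    by_contra! h
    have hE : MeasurableSet {p : X × X | p.1 ∈ B ∧ p.1 - p.2 ∈ A} :=
      (measurable_fst hB).inter ((measurable_fst.sub measurable_snd) hA)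
    have h0 : (μ.prod μ) {p : X × X | p.1 ∈ B ∧ p.1 - p.2 ∈ A} = 0 := by
      rw [Measure.prod_apply_symm hE]
      exact (lintegral_congr h).trans lintegral_zero
    rw [Measure.measure_prod_null hE] at h0
    apply hμB
    refine measure_mono_null (fun y hy => ?_) h0
    simp only [mem_compl_iff, mem_ofPred_eq, Pi.zero_apply]
    intro h1
    apply hμA
    refine absolutelyContinuous_map_sub_left μ y ?_
    rw [Measure.map_apply (by fun_prop) hA]
    simpa [preimage, hy] using h1
  have hmeas : MeasurableSet (B ∩ (fun y => y - x) ⁻¹' A) :=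
    hB.inter ((measurable_id.sub_const x) hA)
  -- Steinhaus: the differences of `B ∩ (A + x)` fill a neighbourhood of `0`, so some `d ∈ D` has `d
  -- - x = a - b`, whence `a = (b - x) + d` is in `B ∩ (A + D)`.
  have hnhds := Measure.sub_mem_nhds_zero_of_addHaar_pos μ _ hmeas (pos_iff_ne_zero.2 hx)
  obtain ⟨d, hdD, hd⟩ := hD.inter_nhds_nonempty
    ((continuous_sub_right x).continuousAt.preimage_mem_nhds (by simpa using hnhds) :
      (fun d => d - x) ⁻¹' _ ∈ 𝓝 x)
  obtain ⟨a, ha, b, hb, hab⟩ := hd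
  refine ⟨a, ha.1, b - x, hb.2, d, hdD, ?_⟩
  simp only at hab ⊢
  rw [← sub_eq_zero] at hab ⊢
  rw [← neg_eq_zero, ← hab]
  abel

theorem measurableSet_add_countable {X : Type*} [AddCommGroup X] [TopologicalSpace X]
    [IsTopologicalAddGroup X] [MeasurableSpace X] [BorelSpace X] {A D : Set X}
    (hA : MeasurableSet A) (hD : D.Countable) : MeasurableSet (A + D) := by
  rw [← iUnion_add_right_image]
  refine MeasurableSet.biUnion hD fun d _ => ?_
  exact (Homeomorph.addRight d).measurableEmbedding.measurableSet_image.2 hA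

/-! ### Families with the Weaker Smital Property that are preserved by Fubini products -/

/-- A family of sets closed under subsets, for which measurable sets have measurable sets of points
with small section, and which has the Weaker Smital Property. -/
structure IsSmitalFamily {X : Type u} [AddCommGroup X] [TopologicalSpace X]
    (𝒜 : MeasurableSpace X) (I : Set (Set X)) : Prop where
  mono : ∀ ⦃A B : Set X⦄, A ⊆ B → B ∈ I → A ∈ I
  measurableSet_section : ∀ {Z : Type u} [MeasurableSpace Z] {E : Set (Z × X)}, MeasurableSet E →
    MeasurableSet {z | {x | (z, x) ∈ E} ∈ I}
  hasWSP : HasWSP 𝒜 I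

theorem isSmitalFamily_meagerIdeal (X : Type u) [AddCommGroup X] [TopologicalSpace X]
    [IsTopologicalAddGroup X] [PolishSpace X] [mX : MeasurableSpace X] [BorelSpace X] :
    IsSmitalFamily mX (meagerIdeal X) where
  mono _ _ h hB := IsMeagre.mono h hB
  measurableSet_section hE := by
    simpa using! measurableSet_setOf_isMeagre_inter hE univ isOpen_univ
  hasWSP := by
    obtain ⟨D, hDc, hD⟩ := exists_countable_dense X
    exact ⟨D, hDc, hD, fun A hA hm => isMeagre_compl_add_dense hA hm hDc hD⟩

theorem isSmitalFamily_nullIdeal (X : Type u) [AddCommGroup X] [TopologicalSpace X]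
    [IsTopologicalAddGroup X] [PolishSpace X] [LocallyCompactSpace X] [mX : MeasurableSpace X]
    [BorelSpace X] : IsSmitalFamily mX (nullIdeal X) where
  mono _ _ h hB := by
    rw [mem_nullIdeal_iff Measure.addHaar] at hB ⊢
    exact measure_mono_null h hB
  measurableSet_section hE := by
    simp only [mem_nullIdeal_iff Measure.addHaar]
    exact measurable_measure_prodMk_left hE (measurableSet_singleton 0)
  hasWSP := by
    obtain ⟨D, hDc, hD⟩ := exists_countable_dense X
    refine ⟨D, hDc, hD, fun A hA hm => ?_⟩
    rw [mem_nullIdeal_iff Measure.addHaar] at hm ⊢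
    by_contra h
    obtain ⟨x, hx, hx'⟩ := inter_add_dense_nonempty Measure.addHaar hA hm
      (measurableSet_add_countable hA hDc).compl h hD
    exact hx hx'

/-- By heredity, shrinking a measurable hull `C` to `K` only shrinks the exceptional set, so a
measurable `K` can serve as its own hull. -/
theorem mem_fubiniProduct_iff {X Y : Type u} {𝒜 : MeasurableSpace X} {ℬ : MeasurableSpace Y}
    {I : Set (Set X)} {J : Set (Set Y)} (hI : ∀ ⦃A B : Set X⦄, A ⊆ B → B ∈ I → A ∈ I)
    (hJ : ∀ ⦃A B : Set Y⦄, A ⊆ B → B ∈ J → A ∈ J) {K : Set (X × Y)} (hK : MeasurableSet K) :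
    K ∈ fubiniProduct 𝒜 ℬ I J ↔ {x | {y | (x, y) ∈ K} ∉ J} ∈ I := by
  constructor
  · rintro ⟨C, -, hKC, hC⟩
    exact hI (fun x hx h => hx (hJ (fun y hy => hKC hy) h)) hC
  · exact fun h => ⟨K, hK, Subset.rfl, h⟩

theorem IsSmitalFamily.fubiniProduct {X Y : Type u} [AddCommGroup X] [TopologicalSpace X]
    [IsTopologicalAddGroup X] [SecondCountableTopology X] [𝒜 : MeasurableSpace X] [BorelSpace X]
    [AddCommGroup Y] [TopologicalSpace Y] [IsTopologicalAddGroup Y] [SecondCountableTopology Y]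
    [ℬ : MeasurableSpace Y] [BorelSpace Y] {I : Set (Set X)} {J : Set (Set Y)}
    (hI : IsSmitalFamily 𝒜 I) (hJ : IsSmitalFamily ℬ J) :
    IsSmitalFamily (𝒜.prod ℬ) (fubiniProduct 𝒜 ℬ I J) where
  mono := by
    rintro A B hAB ⟨C, hC, hBC, h⟩
    exact ⟨C, hC, hAB.trans hBC, h⟩
  measurableSet_section := by
    intro Z _ E hE
    have hsec : ∀ z, MeasurableSet {p : X × Y | (z, p) ∈ E} := fun z => measurable_prodMk_left hE
    simp only [mem_fubiniProduct_iff hI.mono hJ.mono (hsec _)]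
    -- Reassociating makes `Z × X` the parameter space for `J`, and then `Z` the one for `I`; hence
    -- the arbitrary `Z` in `IsSmitalFamily`.
    have hE' : MeasurableSet {q : (Z × X) × Y | (q.1.1, q.1.2, q.2) ∈ E} :=
      MeasurableEquiv.prodAssoc.measurable hE
    exact hI.measurableSet_section (hJ.measurableSet_section hE').compl
  hasWSP := by
    obtain ⟨D₁, hc₁, hd₁, h₁⟩ := hI.hasWSP
    obtain ⟨D₂, hc₂, hd₂, h₂⟩ := hJ.hasWSP
    refine ⟨D₁ ×ˢ D₂, hc₁.prod hc₂, hd₁.prod hd₂, fun A hA hA' => ?_⟩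
    have hS : MeasurableSet (A + D₁ ×ˢ D₂) := measurableSet_add_countable hA (hc₁.prod hc₂)
    rw [mem_fubiniProduct_iff hI.mono hJ.mono hA] at hA'
    rw [mem_fubiniProduct_iff hI.mono hJ.mono hS.compl]
    refine hI.mono ?_ (h₁ _ (hJ.measurableSet_section hA).compl hA')
    rintro x hx ⟨a, ha, d, hd, rfl⟩
    refine hx (hJ.mono ?_ (h₂ _ (measurable_prodMk_left hA) ha))
    rintro y hy ⟨b, hb, e, he, rfl⟩
    exact hy ⟨(a, b), hb, (d, e), ⟨hd, he⟩, rfl⟩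

/-- The topological facts join the induction because second countability makes the product of the
Borel σ-algebras the Borel σ-algebra of the product. -/
theorem Bracketing.isSmitalFamily_fubini {m : ℕ} (X : Fin m → Type u)
    [∀ k, AddCommGroup (X k)] [∀ k, TopologicalSpace (X k)]
    [∀ k, IsTopologicalAddGroup (X k)] [∀ k, SecondCountableTopology (X k)]
    (I : ∀ k, Set (Set (X k))) (hI : ∀ k, IsSmitalFamily (borel (X k)) (I k)) {a b : ℕ}
    (s : Bracketing m a b) :
    IsTopologicalAddGroup (s.Space X) ∧ SecondCountableTopology (s.Space X) ∧
      IsSmitalFamily (borel (s.Space X)) (s.fubini X I) := by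
  induction s with
  | factor k =>
    exact ⟨inferInstanceAs (IsTopologicalAddGroup (X k)),
      inferInstanceAs (SecondCountableTopology (X k)), hI k⟩
  | prod s t ihs iht =>
    obtain ⟨hgs, hcs, hs⟩ := ihs
    obtain ⟨hgt, hct, ht⟩ := iht
    let _ : MeasurableSpace (s.Space X) := borel _
    let _ : MeasurableSpace (t.Space X) := borel _
    have : BorelSpace (s.Space X) := ⟨rfl⟩
    have : BorelSpace (t.Space X) := ⟨rfl⟩
    have h := hs.fubiniProduct ht
    rw [show (borel (s.Space X)).prod (borel (t.Space X)) = borel (s.Space X × t.Space X) from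
      BorelSpace.measurable_eq] at h
    exact ⟨inferInstanceAs (IsTopologicalAddGroup (s.Space X × t.Space X)),
      inferInstanceAs (SecondCountableTopology (s.Space X × t.Space X)), h⟩

end Smital

theorem mainTheorem6 (n : ℕ) (X : Fin (n + 1) → Type u)
    [∀ k, AddCommGroup (X k)] [∀ k, TopologicalSpace (X k)]
    [∀ k, IsTopologicalAddGroup (X k)] [∀ k, PolishSpace (X k)]
    (I : ∀ k, Set (Set (X k)))
    (hI : ∀ k, I k = Smital.meagerIdeal (X k) ∨
      (LocallyCompactSpace (X k) ∧ I k = Smital.nullIdeal (X k)))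
    (s : Smital.Bracketing (n + 1) 0 (n + 1)) :
    Smital.HasWSP (borel (s.Space X)) (s.fubini X I) := by
  refine (s.isSmitalFamily_fubini X I fun k => ?_).2.2.hasWSP
  let _ : MeasurableSpace (X k) := borel _
  have : BorelSpace (X k) := ⟨rfl⟩
  obtain h | ⟨_, h⟩ := hI k
  · rw [h]
    exact Smital.isSmitalFamily_meagerIdeal (X k)
  · rw [h]
    exact Smital.isSmitalFamily_nullIdeal (X k)
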